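/- Let $m\ge 1$ and let $T_m$ be the rooted regular $m$-tree whose vertices are the finite strings over an alphabet $Y$ with $m$ letters, ordered by the prefix relation, the root being the empty string. For an automorphism $\alpha$ of $T_m$ and a vertex $u$, the state $\alpha_u$ of $\alpha$ at $u$ is the automorphism of $T_m$ determined by $\alpha(uw)=\alpha(u)\,\alpha_u(w)$ for all strings $w$. A subgroup $H$ of $\mathrm{Aut}(T_m)$ is state-closed if all the states of its elements belong to $H$, and finite-state if each of its elements has only finitely many states. A group $G$ is an automata group of degree $m$ if there is an injective homomorphism from $G$ to $\mathrm{Aut}(T_m)$ whose image is finitely generated, state-closed and finite-state. Theorem C. Let $A$ be a finitely generated abelian group with (finite) torsion subgroup $B$, let $d\ge 0$ be an integer, and let $A\wr\mathbb{Z}^d=A^{(\mathbb{Z}^d)}\rtimes\mathbb{Z}^d$ be the restricted wreath product, where $A^{(\mathbb{Z}^d)}$ is the group of finitely supported functions $\mathbb{Z}^d\to A$, on which $\mathbb{Z}^d$ acts by translation. Then $A\wr\mathbb{Z}^d$ is an automata group of degree $2|B|+4$. Moreover, for every integer $l\ge 0$, the group $\mathbb{Z}^l\wr\mathbb{Z}^d$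 is an automata group of degree $4$. -/

import Mathlib

/-- The automorphism group of the rooted regular tree `T(Y)`. The vertices of the tree are the
finite strings over the alphabet `Y`, the root is the empty string, and the descendants of a vertex
`u` are the strings having `u` as a prefix. An automorphism is a bijection of the set of vertices
that preserves and reflects the prefix order. The group law is composition. -/
abbrev TreeAut (Y : Type*) : Type _ :=
  ((fun u v : List Y => u <+: v) ≃r (fun u v : List Y => u <+: v))

namespace TreeAut

variable {Y : Type*}

theorem prefix_iff (g : TreeAut Y) (u v : List Y) : g u <+: g v ↔ u <+: v :=
  g.map_rel_iff

/-- The image under `g` of the string `u ++ w` is `g u` followed by a string that is the image of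
`w` under the state of `g` at `u`. -/
theorem append_drop (g : TreeAut Y) (u w : List Y) :
    g u ++ (g (u ++ w)).drop (g u).length = g (u ++ w) :=
  List.prefix_iff_eq_append.1 ((g.prefix_iff _ _).2 (List.prefix_append u w))

/-- The state `g_u` of the tree automorphism `g` at the vertex `u`: the tree automorphism
determined by `g (u ++ w) = g u ++ g_u w` for all strings `w`. -/
def state (g : TreeAut Y) (u : List Y) : TreeAut Y where
  toFun w := (g (u ++ w)).drop (g u).length
  invFun w := (g.symm (g u ++ w)).drop u.length
  left_inv w := by
    simp [append_drop]
  right_inv w := by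
    have h := append_drop g.symm (g u) w
    simp only [RelIso.symm_apply_apply] at h
    simp [h]
  map_rel_iff' {w w'} := by
    change (g (u ++ w)).drop (g u).length <+: (g (u ++ w')).drop (g u).length ↔ w <+: w'
    rw [← List.prefix_append_right_inj (g u), append_drop, append_drop, prefix_iff,
      List.prefix_append_right_inj]

theorem apply_append (g : TreeAut Y) (u w : List Y) : g (u ++ w) = g u ++ g.state u w :=
  (append_drop g u w).symm

/-- The set `Q(g)` of all states of the tree automorphism `g` (including `g` itself, which is its
state at the root). -/
def states (g : TreeAut Y) : Set (TreeAut Y) :=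
  Set.range fun u : List Y => g.state u

/-- A group of tree automorphisms is state-closed (self-similar) if it contains all the states of
each of its elements. -/
def IsStateClosed (H : Subgroup (TreeAut Y)) : Prop :=
  ∀ g ∈ H, g.states ⊆ H

/-- A group of tree automorphisms is finite-state if each of its elements has only finitely many
states. -/
def IsFiniteState (H : Subgroup (TreeAut Y)) : Prop :=
  ∀ g ∈ H, g.states.Finite

end TreeAut

/-- The group `G` is an automata group of degree `m`: it has a faithful representation on the
`m`-tree whose image is finitely generated, state-closed and finite-state. -/
def IsAutomataGroup (m : ℕ) (G : Type*) [Group G] : Prop :=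
  ∃ φ : G →* TreeAut (Fin m), Function.Injective φ ∧
    φ.range.FG ∧ TreeAut.IsStateClosed φ.range ∧ TreeAut.IsFiniteState φ.range

/-- The restricted wreath product of the groups `A` and `Q`: the subgroup of the unrestricted
regular wreath product `A ≀ᵣ Q`, whose elements are pairs of a function `Q → A` and an element
of `Q`, consisting of the pairs whose function has finite support. -/
def RestrictedWreathProduct (A Q : Type*) [Group A] [Group Q] : Subgroup (A ≀ᵣ Q) where
  carrier := {x | (Function.mulSupport x.left).Finite}
  one_mem' := by simp
  mul_mem' {a b} ha hb := by
    have hb' : (Function.mulSupport fun x => b.left (a.right⁻¹ * x)).Finite :=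
      Set.Finite.preimage (mul_right_injective a.right⁻¹).injOn hb
    exact (Set.Finite.union ha hb').subset (Function.mulSupport_mul _ _)
  inv_mem' {a} ha := by
    have ha' : (Function.mulSupport fun x => a.left (a.right * x)).Finite :=
      Set.Finite.preimage (mul_right_injective a.right).injOn ha
    refine ha'.subset fun x hx => ?_
    simpa using hx

/-! A faithful finite-state wreath recursion of a finitely generated group makes it an automata
group, so it suffices to write one down for the wreath product.

Write elements of `Q = ℤ^d` in base `β`, where `β` cyclically shifts the coordinates and doubles the
one that wraps around. Its image has index 2 in every dimension `d ≥ 1`, so two digits suffice. On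
these two letters an element of `A ≀ Q` acts through its top part, and its sections restrict its
finitely supported function to the cosets of `β(Q)`. This loses only elements whose top part is
infinitely divisible by `β`, hence trivial, and it shrinks supports until only the value at `1` is
left. That value is read on a second block of letters: there the element acts through the product of
its values, by a recursion of `A`. Since `A` is abelian, this product is a homomorphism.

For `A = ℤ^l` the number system itself is such a recursion, giving `2 + 2` letters. For `A = ℤ^l ×
B` the finite factor acts on `2|B|` further letters with trivial sections. The main steps are
`recursion_isFaithful` and `recursion_isFiniteState`. -/

/-! ### Wreath recursions and their actions on trees -/

/-- A wreath recursion of the group `G` over the alphabet `Y`: an action of `G` on `Y` together with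
a cocycle `st`, where `st g y` is the state of `g` at the letter `y`. -/
structure WreathRecursion (G Y : Type*) [Group G] where
  /-- The action on the letters. -/
  perm : G →* Equiv.Perm Y
  /-- The state at a letter. -/
  st : G → Y → G
  st_mul : ∀ g h y, st (g * h) y = st g (perm h y) * st h y

namespace WreathRecursion

variable {G Y : Type*} [Group G] (R : WreathRecursion G Y)

/-- No nontrivial normal subgroup acts trivially on the letters and contains its own states. -/
def IsFaithful : Prop :=
  ∀ K : Subgroup G, K.Normal → (∀ k ∈ K, R.perm k = 1 ∧ ∀ y, R.st k y ∈ K) → K = ⊥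

/-- Each element of `G` lies in a finite set that is closed under taking states. -/
def IsFiniteState : Prop :=
  ∀ g, ∃ S : Set G, S.Finite ∧ g ∈ S ∧ ∀ s ∈ S, ∀ y, R.st s y ∈ S

@[simp]
theorem st_one (y : Y) : R.st 1 y = 1 := by
  have h := R.st_mul 1 1 y
  simpa using h

/-- The action of `G` on the strings over `Y`. -/
def act (g : G) : List Y → List Y
  | [] => []
  | y :: w => R.perm g y :: act (R.st g y) w

/-- The state of `g` at a string. -/
def sec (g : G) : List Y → G
  | [] => g
  | y :: w => sec (R.st g y) w

theorem act_one (w : List Y) : R.act 1 w = w := by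
  induction w with
  | nil => rfl
  | cons y w ih => simp [act, ih]

theorem act_mul (g h : G) (w : List Y) : R.act (g * h) w = R.act g (R.act h w) := by
  induction w generalizing g h with
  | nil => rfl
  | cons y w ih => simp [act, ih, R.st_mul]

theorem act_append (g : G) (u w : List Y) :
    R.act g (u ++ w) = R.act g u ++ R.act (R.sec g u) w := by
  induction u generalizing g with
  | nil => rfl
  | cons y u ih => simp [act, sec, ih]

theorem act_prefix (g : G) {u v : List Y} (h : u <+: v) : R.act g u <+: R.act g v := by
  obtain ⟨w, rfl⟩ := h
  rw [act_append]
  exact List.prefix_append _ _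

/-- The homomorphism to the automorphism group of the tree. -/
def toTreeAut : G →* TreeAut Y where
  toFun g :=
    { toFun := R.act g
      invFun := R.act g⁻¹
      left_inv := fun w => by rw [← act_mul, inv_mul_cancel, act_one]
      right_inv := fun w => by rw [← act_mul, mul_inv_cancel, act_one]
      map_rel_iff' := fun {u v} => by
        refine ⟨fun h => ?_, R.act_prefix g⟩
        have h' := R.act_prefix g⁻¹ h
        change R.act g⁻¹ (R.act g u) <+: R.act g⁻¹ (R.act g v) at h'
        simpa [← act_mul, act_one] using h' }
  map_one' := RelIso.ext R.act_one
  map_mul' g h := RelIso.ext (R.act_mul g h)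

theorem toTreeAut_apply (g : G) (w : List Y) : R.toTreeAut g w = R.act g w := rfl

theorem state_toTreeAut (g : G) (u : List Y) :
    (R.toTreeAut g).state u = R.toTreeAut (R.sec g u) := by
  refine RelIso.ext fun w => ?_
  have h := TreeAut.apply_append (R.toTreeAut g) u w
  rw [toTreeAut_apply, act_append] at h
  exact (List.append_cancel_left h).symm

variable {R}

/-- The kernel of the tree action is itself normal, inactive on letters and closed under states. -/
theorem IsFaithful.injective (hR : R.IsFaithful) : Function.Injective R.toTreeAut := by
  rw [← MonoidHom.ker_eq_bot_iff]
  refine hR _ inferInstance fun k hk => ?_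
  have hk' (w : List Y) : R.act k w = w := by
    rw [← toTreeAut_apply, MonoidHom.mem_ker.1 hk]
    rfl
  refine ⟨Equiv.ext fun y => ?_, fun y => ?_⟩
  · simpa [act] using hk' [y]
  · refine MonoidHom.mem_ker.2 (RelIso.ext fun w => ?_)
    have h := hk' (y :: w)
    rw [act, List.cons.injEq] at h
    exact h.2

theorem IsFiniteState.finite_states (hR : R.IsFiniteState) (g : G) :
    (R.toTreeAut g).states.Finite := by
  obtain ⟨S, hS, hg, hst⟩ := hR g
  refine (hS.image R.toTreeAut).subset ?_
  rintro _ ⟨u, rfl⟩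
  refine ⟨R.sec g u, ?_, (R.state_toTreeAut g u).symm⟩
  induction u generalizing g with
  | nil => exact hg
  | cons y u ih => exact ih _ (hst g hg y)

variable (R)

/-- Renaming the letters of a wreath recursion. -/
def reindex {Z : Type*} (e : Y ≃ Z) : WreathRecursion G Z where
  perm := (e.permCongrHom : Equiv.Perm Y →* Equiv.Perm Z).comp R.perm
  st g z := R.st g (e.symm z)
  st_mul g h z := by simp [R.st_mul, Equiv.permCongrHom]

/-- Restriction of a wreath recursion along a group isomorphism. -/
def transport {H : Type*} [Group H] (e : H ≃* G) : WreathRecursion H Y where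
  perm := R.perm.comp (e : H →* G)
  st g z := e.symm (R.st (e g) z)
  st_mul g h z := by simp [R.st_mul]

end WreathRecursion

/-! ### Faithful finite-state recursions -/

/-- The group `G` has a faithful finite-state wreath recursion over the alphabet `Y`. -/
def HasFaithfulFiniteStateRecursion (G Y : Type*) [Group G] : Prop :=
  ∃ R : WreathRecursion G Y, R.IsFaithful ∧ R.IsFiniteState

namespace HasFaithfulFiniteStateRecursion

open WreathRecursion

variable {G Y : Type*} [Group G]

theorem reindex {Z : Type*} (h : HasFaithfulFiniteStateRecursion G Y) (e : Y ≃ Z) :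
    HasFaithfulFiniteStateRecursion G Z := by
  obtain ⟨R, hR, hR'⟩ := h
  refine ⟨R.reindex e, fun K hK hst => hR K hK fun k hk => ?_, fun g => ?_⟩
  · obtain ⟨h1, h2⟩ := hst k hk
    refine ⟨e.permCongrHom.injective ?_, fun y => ?_⟩
    · rw [map_one]
      exact h1
    · simpa [WreathRecursion.reindex] using h2 (e y)
  · obtain ⟨S, hS, hg, hst⟩ := hR' g
    exact ⟨S, hS, hg, fun s hs z => hst s hs _⟩

theorem transport {H : Type*} [Group H] (h : HasFaithfulFiniteStateRecursion G Y) (e : H ≃* G) :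
    HasFaithfulFiniteStateRecursion H Y := by
  obtain ⟨R, hR, hR'⟩ := h
  refine ⟨R.transport e, fun K hK hst => ?_, fun g => ?_⟩
  · have hbot : K.map (e : H →* G) = ⊥ := by
      refine hR _ (hK.map _ e.surjective) ?_
      rintro _ ⟨k, hk, rfl⟩
      obtain ⟨h1, h2⟩ := hst k hk
      exact ⟨h1, fun y => ⟨_, h2 y, e.apply_symm_apply _⟩⟩
    exact (Subgroup.map_eq_bot_iff_of_injective K e.injective).1 hbot
  · obtain ⟨S, hS, hg, hst⟩ := hR' (e g)
    refine ⟨e ⁻¹' S, hS.preimage e.injective.injOn, hg, fun s hs y => ?_⟩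
    simpa [WreathRecursion.transport] using hst _ hs y

/-- A finitely generated group with a faithful finite-state wreath recursion over an alphabet with
`m` letters is an automata group of degree `m`. -/
theorem isAutomataGroup [Group.FG G] [Finite Y] {m : ℕ} (hm : Nat.card Y = m)
    (h : HasFaithfulFiniteStateRecursion G Y) : IsAutomataGroup m G := by
  obtain ⟨R, hR, hR'⟩ := h.reindex (Finite.equivFinOfCardEq hm)
  refine ⟨R.toTreeAut, hR.injective, (Group.fg_iff_subgroup_fg _).1 inferInstance, ?_, ?_⟩
  · rintro _ ⟨g, rfl⟩ _ ⟨u, rfl⟩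
    exact ⟨R.sec g u, (R.state_toTreeAut g u).symm⟩
  · rintro _ ⟨g, rfl⟩
    exact hR'.finite_states g

end HasFaithfulFiniteStateRecursion

/-- The factor `B` is seen already on the letters in `P`, where sections are trivial. Sections at
`Y` may therefore forget it. -/
theorem HasFaithfulFiniteStateRecursion.prod_finite {G Y B P : Type*} [Group G] [Group B] [Finite B]
    (h : HasFaithfulFiniteStateRecursion G Y) (ρ : B →* Equiv.Perm P)
    (hρ : Function.Injective ρ) : HasFaithfulFiniteStateRecursion (G × B) (Y ⊕ P) := by
  obtain ⟨R, hR, hR'⟩ := h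
  let T : WreathRecursion (G × B) (Y ⊕ P) :=
    { perm := (Equiv.Perm.sumCongrHom Y P).comp (R.perm.prodMap ρ)
      st := fun g => Sum.elim (fun y => (R.st g.1 y, 1)) (fun _ => 1)
      st_mul := by
        rintro g h (y | p)
        · simp [R.st_mul]
        · simp }
  refine ⟨T, fun K hK hst => ?_, fun g => ?_⟩
  · have hbot : K.comap (MonoidHom.inl G B) = ⊥ := by
      refine hR _ inferInstance fun g hg => ?_
      obtain ⟨h1, h2⟩ := hst _ hg
      refine ⟨Equiv.ext fun y => ?_, fun y => h2 (Sum.inl y)⟩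
      simpa [T] using Equiv.congr_fun h1 (Sum.inl y)
    refine (Subgroup.eq_bot_iff_forall K).2 ?_
    rintro ⟨g, b⟩ hk
    have hb : b = 1 := by
      refine (map_eq_one_iff ρ hρ).1 (Equiv.ext fun p => ?_)
      simpa [T] using Equiv.congr_fun (hst _ hk).1 (Sum.inr p)
    subst hb
    have hg : g ∈ K.comap (MonoidHom.inl G B) := hk
    rw [hbot, Subgroup.mem_bot] at hg
    rw [hg]
    rfl
  · obtain ⟨S, hS, hg, hst⟩ := hR' g.1
    refine ⟨insert 1 (S ×ˢ Set.univ), (hS.prod Set.finite_univ).insert 1, Or.inr ⟨hg, trivial⟩, ?_⟩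
    rintro s (rfl | hs) y
    · rw [T.st_one]
      exact Or.inl rfl
    · rcases y with y | p
      · exact Or.inr ⟨hst _ hs.1 y, trivial⟩
      · exact Or.inl rfl

/-! ### Number systems on abelian groups -/

/-- A positional number system on the abelian group `Q`: a wreath recursion given by division with
remainder, with respect to an injective endomorphism `base` and digits indexed by `Y`. -/
structure NumberSystem (Q Y : Type*) [CommGroup Q] extends WreathRecursion Q Y where
  /-- The endomorphism that plays the role of multiplication by the base. -/
  base : Q →* Q
  base_injective : Function.Injective base
  /-- The digits. -/
  digit : Y → Q
  /-- The letter of the trivial digit. -/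
  zero : Y
  digit_zero : digit zero = 1
  eq_one_of_digit_mul_base : ∀ y z, digit y * base z = 1 → z = 1
  digit_perm : ∀ q y, digit (perm q y) * base (st q y) = q * digit y
  eq_one_of_mem_range : ∀ q, (∀ n, q ∈ Set.range base^[n]) → q = 1
  exists_finite : ∀ F : Set Q, F.Finite → ∃ E : Set Q, E.Finite ∧ F ⊆ E ∧
    ∀ y y' z, digit y * base z * (digit y')⁻¹ ∈ E → z ∈ E

namespace NumberSystem

variable {Q Y : Type*} [CommGroup Q] (N : NumberSystem Q Y)

theorem eq_base_of_perm_eq_one {q : Q} (h : N.perm q = 1) : q = N.base (N.st q N.zero) := by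
  simpa [h, N.digit_zero] using (N.digit_perm q N.zero).symm

theorem st_mem {E : Set Q} (hE : ∀ y y' z, N.digit y * N.base z * (N.digit y')⁻¹ ∈ E → z ∈ E)
    {q : Q} (hq : q ∈ E) (y : Y) : N.st q y ∈ E := by
  refine hE (N.perm q y) y _ ?_
  rwa [N.digit_perm, mul_inv_cancel_right]

/-- An element fixing all letters is `base` of its state at the zero digit; iterating puts it in the
range of every power of `base`. -/
theorem isFaithful : N.IsFaithful := by
  intro K _ hst
  refine (Subgroup.eq_bot_iff_forall K).2 fun q hq => N.eq_one_of_mem_range q fun n => ?_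
  induction n generalizing q with
  | zero => exact ⟨q, rfl⟩
  | succ n ih =>
    obtain ⟨p, hp⟩ := ih _ ((hst q hq).2 N.zero)
    refine ⟨p, ?_⟩
    rw [Function.iterate_succ_apply', hp, ← N.eq_base_of_perm_eq_one (hst q hq).1]

theorem isFiniteState : N.IsFiniteState := by
  intro q
  obtain ⟨E, hE, hq, hst⟩ := N.exists_finite {q} (Set.finite_singleton q)
  exact ⟨E, hE, hq rfl, fun s hs y => N.st_mem hst hs y⟩

end NumberSystem

/-! ### Restricted wreath products: generation -/

namespace RestrictedWreathProduct

open RegularWreathProduct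

section Group

variable {A Q : Type*} [Group A] [Group Q]

@[ext]
theorem ext {g h : RestrictedWreathProduct A Q} (hl : g.1.left = h.1.left)
    (hr : g.1.right = h.1.right) : g = h :=
  Subtype.ext (RegularWreathProduct.ext hl hr)

/-- The embedding of the top group. -/
def top : Q →* RestrictedWreathProduct A Q :=
  inl.codRestrict _ fun q => by simp [RestrictedWreathProduct]

variable (A Q) in
/-- The projection to the top group. -/
def proj : RestrictedWreathProduct A Q →* Q :=
  rightHom.comp (RestrictedWreathProduct A Q).subtype

open Classical in
/-- The embedding of the base group as the functions supported at `1`. -/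
noncomputable def single : A →* RestrictedWreathProduct A Q where
  toFun a := ⟨⟨Pi.mulSingle 1 a, 1⟩,
    (Set.finite_singleton (1 : Q)).subset Pi.mulSupport_mulSingle_subset⟩
  map_one' := by ext <;> simp
  map_mul' a b := by
    ext x
    · simp [Pi.mulSingle_mul]
    · simp

@[simp] theorem top_left (q : Q) : (top q : RestrictedWreathProduct A Q).1.left = 1 := rfl
@[simp] theorem top_right (q : Q) : (top q : RestrictedWreathProduct A Q).1.right = q := rfl
open Classical in
@[simp] theorem single_left (a : A) :
    (single a : RestrictedWreathProduct A Q).1.left = Pi.mulSingle 1 a := rfl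
@[simp] theorem single_right (a : A) :
    (single a : RestrictedWreathProduct A Q).1.right = 1 := rfl

/-- A finitely supported function is a finite product of translates of functions supported at `1`,
and translation is conjugation by the top group. -/
theorem range_single_sup_range_top :
    (single : A →* RestrictedWreathProduct A Q).range ⊔ top.range = ⊤ := by
  classical
  set H := (single : A →* RestrictedWreathProduct A Q).range ⊔ top.range
  have htop (q : Q) : top q ∈ H := Subgroup.mem_sup_right ⟨q, rfl⟩
  have hsingle (a : A) : single a ∈ H := Subgroup.mem_sup_left ⟨a, rfl⟩
  have key (s : Finset Q) : ∀ g : RestrictedWreathProduct A Q, g.1.right = 1 →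
      Function.mulSupport g.1.left ⊆ s → g ∈ H := by
    induction s using Finset.induction_on with
    | empty =>
      intro g hr hs
      have hl : g.1.left = 1 := by simpa using hs
      have : g = 1 := by ext1 <;> simp [hl, hr]
      rw [this]
      exact H.one_mem
    | insert p s _ ih =>
      intro g hr hs
      -- This conjugate is supported at `p` with the value of `g` there; dividing by it removes `p`
      -- from the support.
      have hp : top p * single (g.1.left p) * (top p)⁻¹ ∈ H :=
        H.mul_mem (H.mul_mem (htop p) (hsingle _)) (H.inv_mem (htop p))
      rw [← H.mul_mem_cancel_left (H.inv_mem hp)]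
      refine ih _ (by simp [hr]) fun x hx => ?_
      by_contra hxs
      refine hx ?_
      rcases eq_or_ne x p with rfl | hxp
      · simp
      · have h1 : x ∉ Function.mulSupport g.1.left := fun h => by
          have := hs h
          simp_all
        have h2 : p⁻¹ * x ≠ 1 := fun h => hxp (inv_mul_eq_one.1 h).symm
        have h3 : Pi.mulSingle (M := fun _ => A) 1 (g.1.left p) (p⁻¹ * x) = 1 :=
          Pi.mulSingle_eq_of_ne h2 _
        simp_all
  refine (Subgroup.eq_top_iff' H).2 fun g => ?_
  rw [← H.mul_mem_cancel_right (H.inv_mem (htop g.1.right))]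
  have hfin : (Function.mulSupport g.1.left).Finite := g.2
  refine key hfin.toFinset _ (by simp) ?_
  rw [hfin.coe_toFinset]
  simp

instance fg [Group.FG A] [Group.FG Q] : Group.FG (RestrictedWreathProduct A Q) := by
  rw [Group.fg_def, ← range_single_sup_range_top]
  exact ((Group.fg_iff_subgroup_fg _).1 inferInstance).sup
    ((Group.fg_iff_subgroup_fg _).1 inferInstance)

end Group

/-! ### The wreath recursion of a restricted wreath product -/

section Recursion

variable {A Q Y P : Type*} [CommGroup A] [CommGroup Q]

variable (A Q) in
/-- The product of the values of the function part. -/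
noncomputable def augmentation : RestrictedWreathProduct A Q →* A where
  toFun g := ∏ᶠ x, g.1.left x
  map_one' := by simp
  map_mul' g h := by
    have hh : (Function.mulSupport fun x => h.1.left (g.1.right⁻¹ * x)).Finite :=
      Set.Finite.preimage (mul_right_injective _).injOn h.2
    refine (finprod_mul_distrib g.2 hh).trans ?_
    congr 1
    exact finprod_comp_equiv (Equiv.mulLeft g.1.right⁻¹)

theorem augmentation_single (a : A) :
    augmentation A Q (single a) = a := by
  classical
  refine (finprod_eq_single _ 1 fun x hx => ?_).trans ?_
  · exact Pi.mulSingle_eq_of_ne (M := fun _ : Q => A) hx a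
  · exact Pi.mulSingle_eq_same (M := fun _ : Q => A) 1 a

/-- The section of an element of the wreath product at a digit of a number system. -/
def baseSection (N : NumberSystem Q Y) (g : RestrictedWreathProduct A Q) (y : Y) :
    RestrictedWreathProduct A Q :=
  ⟨⟨fun z => g.1.left (N.digit (N.perm g.1.right y) * N.base z), N.st g.1.right y⟩,
    Set.Finite.preimage ((mul_right_injective _).comp N.base_injective).injOn g.2⟩

/-- The wreath recursion of a restricted wreath product of abelian groups, given by a number system
on the top group and a wreath recursion of the base group. -/
noncomputable def recursion (N : NumberSystem Q Y) (R : WreathRecursion A P) :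
    WreathRecursion (RestrictedWreathProduct A Q) (Y ⊕ P) where
  perm := (Equiv.Perm.sumCongrHom Y P).comp
    ((N.perm.comp (proj A Q)).prod (R.perm.comp (augmentation A Q)))
  st g := Sum.elim (baseSection N g) fun p => single (R.st (augmentation A Q g) p)
  st_mul := by
    rintro g h (y | p)
    · ext z
      · change g.1.left _ * h.1.left _ = g.1.left _ * h.1.left _
        -- The two points at which `h` is evaluated agree by division with remainder for
        -- `g.1.right`, rearranged using commutativity of `Q`.
        have e := N.digit_perm g.1.right (N.perm h.1.right y)
        congr 2
        · change N.digit (N.perm (g.1.right * h.1.right) y) * _ = _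
          rw [map_mul]
          rfl
        · change g.1.right⁻¹ * (N.digit (N.perm (g.1.right * h.1.right) y) * N.base z) =
            N.digit (N.perm h.1.right y) *
              N.base ((N.st g.1.right (N.perm h.1.right y))⁻¹ * z)
          rw [map_mul, map_mul N.base, map_inv, Equiv.Perm.mul_apply,
            eq_mul_inv_of_mul_eq e]
          simp only [mul_comm, mul_left_comm, mul_assoc, mul_inv_cancel_left]
      · exact N.st_mul _ _ _
    · simp [R.st_mul]

/-- The top parts vanish as for a number system. Repeated sections at the zero digit then isolate
the value at `1`, which faithfulness of `R` kills; conjugation carries this to every other point. -/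
theorem recursion_isFaithful (N : NumberSystem Q Y) {R : WreathRecursion A P}
    (hR : R.IsFaithful) : (recursion N R).IsFaithful := by
  classical
  intro K hK hst
  have hA : K.comap (single : A →* RestrictedWreathProduct A Q) = ⊥ := by
    refine hR _ inferInstance fun a ha => ?_
    obtain ⟨h1, h2⟩ := hst _ ha
    refine ⟨Equiv.ext fun p => ?_, fun p => ?_⟩
    · simpa [recursion, augmentation_single] using Equiv.congr_fun h1 (Sum.inr p)
    · simpa [recursion, augmentation_single] using h2 (Sum.inr p)
  have hperm {g} (hg : g ∈ K) : N.perm g.1.right = 1 := by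
    refine Equiv.ext fun y => ?_
    simpa [recursion, proj] using Equiv.congr_fun (hst _ hg).1 (Sum.inl y)
  have hright (n : ℕ) : ∀ g ∈ K, g.1.right ∈ Set.range N.base^[n] := by
    induction n with
    | zero => exact fun g _ => ⟨_, rfl⟩
    | succ n ih =>
      intro g hg
      obtain ⟨p, hp⟩ := ih _ ((hst g hg).2 (Sum.inl N.zero))
      refine ⟨p, ?_⟩
      rw [Function.iterate_succ_apply', hp]
      exact (N.eq_base_of_perm_eq_one (hperm hg)).symm
  have hright' (g) (hg : g ∈ K) : g.1.right = 1 :=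
    N.eq_one_of_mem_range _ fun n => hright n g hg
  have hiter (n : ℕ) : ∀ g ∈ K, ∃ k ∈ K, k.1.left = g.1.left ∘ N.base^[n] := by
    induction n with
    | zero => exact fun g hg => ⟨g, hg, rfl⟩
    | succ n ih =>
      intro g hg
      obtain ⟨k, hk, e⟩ := ih g hg
      refine ⟨_, (hst k hk).2 (Sum.inl N.zero), funext fun z => ?_⟩
      change k.1.left (N.digit (N.perm k.1.right N.zero) * N.base z) = _
      rw [hperm hk, Equiv.Perm.one_apply, N.digit_zero, one_mul, e, Function.iterate_succ]
      rfl
  have hone (g) (hg : g ∈ K) : g.1.left 1 = 1 := by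
    -- The ranges of the powers of `base` decrease to `1`, so one `n` separates `1` from the rest of
    -- the finite support.
    obtain ⟨n, hn⟩ : ∃ n, ∀ x ∈ Function.mulSupport g.1.left, x ∈ Set.range N.base^[n] → x = 1 := by
      have anti {m n : ℕ} (h : m ≤ n) : Set.range N.base^[n] ⊆ Set.range N.base^[m] := by
        rintro _ ⟨x, rfl⟩
        refine ⟨N.base^[n - m] x, ?_⟩
        rw [← Function.iterate_add_apply, Nat.add_sub_cancel' h]
      have hex (x : Q) : ∃ n, x ∈ Set.range N.base^[n] → x = 1 := by
        by_contra! h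
        exact (h 0).2 (N.eq_one_of_mem_range x fun n => (h n).1)
      choose f hf using hex
      obtain ⟨n, hn⟩ := (Set.Finite.image f g.2).bddAbove
      exact ⟨n, fun x hx hx' => hf x (anti (hn ⟨x, hx, rfl⟩) hx')⟩
    obtain ⟨k, hk, e⟩ := hiter n g hg
    have hk' : k = single (g.1.left 1) := by
      ext x
      · rw [e, single_left, Function.comp_apply]
        rcases eq_or_ne x 1 with rfl | hx
        · rw [Pi.mulSingle_eq_same, iterate_map_one]
        · rw [Pi.mulSingle_eq_of_ne hx]
          by_contra h
          refine hx ((N.base_injective.iterate n) ?_)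
          rw [iterate_map_one]
          exact hn _ h ⟨x, rfl⟩
      · exact hright' k hk
    have hmem : g.1.left 1 ∈ K.comap (single : A →* RestrictedWreathProduct A Q) := by
      rw [Subgroup.mem_comap, ← hk']
      exact hk
    rwa [hA, Subgroup.mem_bot] at hmem
  refine (Subgroup.eq_bot_iff_forall K).2 fun g hg => ?_
  ext q
  -- Conjugation by `top q⁻¹` moves the value at `q` to `1`.
  · have h := hone _ (hK.conj_mem g hg (top q⁻¹))
    simpa [hright' g hg] using h
  · exact hright' g hg

/-- Sections at `Y` keep the top part and the support in a fixed finite set and create no new values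
except possibly `1`. Sections at `P` are singles, whose entries range over the finitely many states
of finitely many augmentations. -/
theorem recursion_isFiniteState (N : NumberSystem Q Y) {R : WreathRecursion A P}
    (hR : R.IsFiniteState) : (recursion N R).IsFiniteState := by
  classical
  intro g
  obtain ⟨E, hE, hgE, hst⟩ := N.exists_finite (insert g.1.right (Function.mulSupport g.1.left))
    (g.2.insert _)
  set V : Set A := insert 1 (g.1.left '' (Function.mulSupport g.1.left))
  have hV : V.Finite := (g.2.image _).insert 1
  let S : Set (RestrictedWreathProduct A Q) :=
    {s | s.1.right ∈ E ∧ Function.mulSupport s.1.left ⊆ E ∧ ∀ x, s.1.left x ∈ V}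
  have hS : S.Finite := by
    have := hE.to_subtype
    refine Set.Finite.of_injOn (f := fun s => ((fun x : E => s.1.left x), s.1.right))
      (t := Set.pi Set.univ (fun _ => V) ×ˢ E) ?_ ?_ ?_
    · exact fun s hs => ⟨fun x _ => hs.2.2 x, hs.1⟩
    · intro s hs t ht h
      simp only [Prod.mk.injEq] at h
      ext x
      · by_cases hx : x ∈ E
        · exact congrFun h.1 ⟨x, hx⟩
        · rw [Function.notMem_mulSupport.1 fun h => hx (hs.2.1 h),
            Function.notMem_mulSupport.1 fun h => hx (ht.2.1 h)]
      · exact h.2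
    · exact (Set.Finite.pi fun _ => hV).prod hE
  have hSst (s) (hs : s ∈ S) (y : Y) : baseSection N s y ∈ S := by
    refine ⟨N.st_mem hst hs.1 y, fun z hz => ?_, fun z => hs.2.2 _⟩
    -- Taking the zero digit for `y'` turns the closure property of `E` into the statement about
    -- supports.
    refine hst (N.perm s.1.right y) N.zero z ?_
    rw [N.digit_zero, inv_one, mul_one]
    exact hs.2.1 hz
  choose T hT hmem hTst using hR
  let U : Set A := insert 1 (⋃ s ∈ S, T (augmentation A Q s))
  have hU : U.Finite := (hS.biUnion fun s _ => hT _).insert 1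
  have hUst (a) (ha : a ∈ U) (p : P) : R.st a p ∈ U := by
    rcases ha with rfl | ha
    · rw [R.st_one]
      exact Or.inl rfl
    · obtain ⟨s, hs, ha⟩ := Set.mem_iUnion₂.1 ha
      exact Or.inr (Set.mem_iUnion₂.2 ⟨s, hs, hTst _ _ ha p⟩)
  -- Only the trivial element solves `digit y * base z = 1`, so the value at `1` stays at `1` or is
  -- lost; it never moves elsewhere.
  have hsingle (a : A) (y : Y) : baseSection N (single a) y = single a ∨
      baseSection N (single a : RestrictedWreathProduct A Q) y = 1 := by
    have hst1 : N.st 1 y = 1 := N.st_one y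
    by_cases hy : N.digit y = 1
    · left
      ext z
      · simp only [baseSection, single_right, single_left, map_one, Equiv.Perm.one_apply, hy,
          one_mul]
        rcases eq_or_ne z 1 with rfl | hz
        · rw [map_one]
        · rw [Pi.mulSingle_eq_of_ne hz, Pi.mulSingle_eq_of_ne]
          exact (map_ne_one_iff N.base N.base_injective).2 hz
      · exact hst1
    · right
      ext z
      · simp only [baseSection, single_right, single_left, map_one, Equiv.Perm.one_apply]
        refine Pi.mulSingle_eq_of_ne (fun h => hy ?_) _
        rwa [N.eq_one_of_digit_mul_base y z h, map_one, mul_one] at h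
      · exact hst1
  have hone : (1 : RestrictedWreathProduct A Q) ∈ single '' U := ⟨1, Or.inl rfl, map_one _⟩
  refine ⟨S ∪ single '' U, hS.union (hU.image _), Or.inl ⟨hgE (Or.inl rfl), fun x hx =>
    hgE (Or.inr hx), fun x => ?_⟩, ?_⟩
  · by_cases hx : g.1.left x = 1
    · exact Or.inl hx
    · exact Or.inr ⟨x, hx, rfl⟩
  · rintro s (hs | ⟨a, ha, rfl⟩) (y | p)
    · exact Or.inl (hSst s hs y)
    · exact Or.inr ⟨_, hUst _ (Or.inr (Set.mem_iUnion₂.2 ⟨s, hs, hmem _⟩)) p, rfl⟩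
    · rcases hsingle a y with h | h
      · exact Or.inr ⟨a, ha, h.symm⟩
      · refine Or.inr ?_
        change baseSection N (single a) y ∈ _
        rwa [h]
    · refine Or.inr ⟨_, hUst a ha p, ?_⟩
      change _ = single (R.st (augmentation A Q (single a)) p)
      rw [augmentation_single]

theorem hasFaithfulFiniteStateRecursion (N : NumberSystem Q Y)
    (h : HasFaithfulFiniteStateRecursion A P) :
    HasFaithfulFiniteStateRecursion (RestrictedWreathProduct A Q) (Y ⊕ P) := by
  obtain ⟨R, hR, hR'⟩ := h
  exact ⟨recursion N R, recursion_isFaithful N hR, recursion_isFiniteState N hR'⟩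

end Recursion

end RestrictedWreathProduct

/-! ### The binary number system on the integer lattice -/

section IntegerLattice

/-- The endomorphism of the lattice `Fin (n + 1) → ℤ` that permutes the coordinates cyclically and
doubles one of them. -/
def latticeBase (n : ℕ) : Multiplicative (Fin (n + 1) → ℤ) →* Multiplicative (Fin (n + 1) → ℤ) :=
  AddMonoidHom.toMultiplicative
    { toFun := fun z => Fin.cons (2 * z (Fin.last n)) fun i => z i.castSucc
      map_zero' := by
        ext i
        refine Fin.cases ?_ (fun i => ?_) i <;> simp
      map_add' := fun z w => by
        ext i
        refine Fin.cases ?_ (fun i => ?_) i <;> simp [mul_add] }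

/-- The digits `0` and `1` in the first coordinate. -/
def latticeDigit (n : ℕ) (b : Bool) : Multiplicative (Fin (n + 1) → ℤ) :=
  Multiplicative.ofAdd (Fin.cons (cond b 1 0) 0)

/-- The action on the digits by the parity of the first coordinate. -/
def latticePerm (n : ℕ) : Multiplicative (Fin (n + 1) → ℤ) →* Equiv.Perm Bool where
  toFun q :=
    { toFun := fun b => xor (q.toAdd 0).bodd b
      invFun := fun b => xor (q.toAdd 0).bodd b
      left_inv := fun b => by simp
      right_inv := fun b => by simp }
  map_one' := Equiv.ext fun b => by simp
  map_mul' p q := Equiv.ext fun b => by simp [Int.bodd_add]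

/-- The quotient of the division of `q + b` by the base. -/
def latticeQuot (n : ℕ) (q : Multiplicative (Fin (n + 1) → ℤ)) (b : Bool) :
    Multiplicative (Fin (n + 1) → ℤ) :=
  Multiplicative.ofAdd
    (Fin.snoc (fun i : Fin n => q.toAdd i.succ) ((q.toAdd 0 + cond b 1 0).div2))

variable {n : ℕ}

@[simp]
theorem latticeBase_zero (z : Multiplicative (Fin (n + 1) → ℤ)) :
    (latticeBase n z).toAdd 0 = 2 * z.toAdd (Fin.last n) := rfl

@[simp]
theorem latticeBase_succ (z : Multiplicative (Fin (n + 1) → ℤ)) (i : Fin n) :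
    (latticeBase n z).toAdd i.succ = z.toAdd i.castSucc := rfl

@[simp]
theorem latticeDigit_zero (b : Bool) : (latticeDigit n b).toAdd 0 = cond b 1 0 := rfl

@[simp]
theorem latticeDigit_succ (b : Bool) (i : Fin n) : (latticeDigit n b).toAdd i.succ = 0 := rfl

theorem latticeBase_injective : Function.Injective (latticeBase n) := by
  intro z w h
  refine Multiplicative.toAdd.injective (funext fun i => ?_)
  refine Fin.lastCases ?_ (fun i => ?_) i
  · have h0 := congrArg (fun v => v.toAdd 0) h
    simpa using h0
  · have h1 := congrArg (fun v => v.toAdd i.succ) h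
    simpa using h1

theorem latticeDigit_perm (q : Multiplicative (Fin (n + 1) → ℤ)) (b : Bool) :
    latticeDigit n (latticePerm n q b) * latticeBase n (latticeQuot n q b) =
      q * latticeDigit n b := by
  refine Multiplicative.toAdd.injective (funext fun i => ?_)
  refine Fin.cases ?_ (fun i => ?_) i
  · have h := Int.bodd_add_div2 (q.toAdd 0 + cond b 1 0)
    have hb : (cond b 1 0 : ℤ).bodd = b := by cases b <;> rfl
    rw [Int.bodd_add, hb] at h
    simpa [latticePerm, latticeQuot] using h
  · simp [latticeQuot]

/-- Traced back through the iterates, coordinate `i` reaches the doubled position after `i` steps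
and again every `n + 1` steps. The hypothesis says that at least `k + 1` doublings have occurred. -/
theorem two_pow_dvd_of_mem_range (e : ℕ) : ∀ q ∈ Set.range (latticeBase n)^[e],
    ∀ (i : Fin (n + 1)) (k : ℕ), i.val + (n + 1) * k < e → (2 : ℤ) ^ (k + 1) ∣ q.toAdd i := by
  induction e with
  | zero => exact fun q _ i k h => absurd h (Nat.not_lt_zero _)
  | succ e ih =>
    rintro _ ⟨p, rfl⟩ i k h
    rw [Function.iterate_succ_apply']
    have hp := ih _ ⟨p, rfl⟩
    revert h
    refine Fin.cases (fun h => ?_) (fun i h => ?_) i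
    · rw [latticeBase_zero, pow_succ']
      refine mul_dvd_mul_left 2 ?_
      cases k with
      | zero => simp
      | succ k =>
        refine hp (Fin.last n) k ?_
        simp only [Fin.val_zero, Fin.val_last] at h ⊢
        linarith
    · rw [latticeBase_succ]
      refine hp _ k ?_
      simp only [Fin.val_succ, Fin.val_castSucc] at h ⊢
      linarith

theorem lattice_eq_one_of_mem_range (q : Multiplicative (Fin (n + 1) → ℤ))
    (h : ∀ e, q ∈ Set.range (latticeBase n)^[e]) : q = 1 := by
  refine Multiplicative.toAdd.injective (funext fun i => ?_)
  set k := (q.toAdd i).natAbs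
  -- With `k` the absolute value of the coordinate, the divisor `2 ^ (k + 1)` exceeds it, so the
  -- coordinate is zero.
  have hdvd := two_pow_dvd_of_mem_range _ q (h (i.val + (n + 1) * k + 1)) i k (Nat.lt_succ_self _)
  refine Int.eq_zero_of_abs_lt_dvd hdvd ?_
  rw [Int.abs_eq_natAbs]
  exact_mod_cast Nat.lt_two_pow_self.trans (Nat.pow_lt_pow_right one_lt_two (Nat.lt_succ_self k))

theorem lattice_exists_finite (F : Set (Multiplicative (Fin (n + 1) → ℤ))) (hF : F.Finite) :
    ∃ E : Set (Multiplicative (Fin (n + 1) → ℤ)), E.Finite ∧ F ⊆ E ∧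
      ∀ y y' z, latticeDigit n y * latticeBase n z * (latticeDigit n y')⁻¹ ∈ E → z ∈ E := by
  obtain ⟨M, hM⟩ := (hF.image fun q => ∑ i, |q.toAdd i|).bddAbove
  -- In a box of radius `r`, the new last coordinate has absolute value at most `(r + 1) / 2`, which
  -- is at most `r` once `r ≥ 1`; hence the maximum with `1`.
  refine ⟨{q | ∀ i, |q.toAdd i| ≤ max M 1}, ?_, fun q hq i => ?_, fun y y' z hz i => ?_⟩
  · refine (Set.finite_Icc (fun _ : Fin (n + 1) => -max M 1) fun _ => max M 1).subset ?_
    exact fun q hq => ⟨fun i => (abs_le.1 (hq i)).1, fun i => (abs_le.1 (hq i)).2⟩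
  · exact (Finset.single_le_sum (f := fun i => |q.toAdd i|) (fun i _ => abs_nonneg _)
      (Finset.mem_univ i)).trans ((hM ⟨q, hq, rfl⟩).trans (le_max_left _ _))
  · refine Fin.lastCases ?_ (fun i => ?_) i
    · have h0 := hz 0
      have h1 : 1 ≤ max M 1 := le_max_right _ _
      rw [toAdd_mul, toAdd_mul, toAdd_inv, Pi.add_apply, Pi.add_apply, Pi.neg_apply,
        latticeBase_zero, latticeDigit_zero, latticeDigit_zero, abs_le] at h0
      rw [abs_le]
      cases y <;> cases y' <;> simp only [cond_true, cond_false] at h0 <;> omega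
    · simpa using hz i.succ

/-- The binary number system on `Fin (n + 1) → ℤ`. -/
def latticeNumberSystem (n : ℕ) : NumberSystem (Multiplicative (Fin (n + 1) → ℤ)) Bool where
  perm := latticePerm n
  st := latticeQuot n
  st_mul p q b := by
    -- Both sides are quotients of `p * q * digit b` with the same remainder, and `base` is
    -- injective.
    refine latticeBase_injective ?_
    refine mul_left_cancel (a := latticeDigit n (latticePerm n (p * q) b)) ?_
    rw [latticeDigit_perm, map_mul (latticePerm n), Equiv.Perm.mul_apply, map_mul, ← mul_assoc,
      latticeDigit_perm, mul_assoc, ← latticeDigit_perm q, mul_assoc]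
  base := latticeBase n
  base_injective := latticeBase_injective
  digit := latticeDigit n
  zero := false
  digit_zero := Multiplicative.toAdd.injective <| funext fun i => by
    refine Fin.cases ?_ (fun i => ?_) i <;> simp
  eq_one_of_digit_mul_base b z h := by
    refine Multiplicative.toAdd.injective (funext fun i => ?_)
    refine Fin.lastCases ?_ (fun i => ?_) i
    · have h0 := congrArg (fun v => v.toAdd 0) h
      simp only [toAdd_mul, Pi.add_apply, latticeBase_zero, latticeDigit_zero, toAdd_one,
        Pi.zero_apply] at h0 ⊢
      cases b <;> simp only [cond_true, cond_false] at h0 <;> omega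
    · have h1 := congrArg (fun v => v.toAdd i.succ) h
      simpa using h1
  digit_perm := latticeDigit_perm
  eq_one_of_mem_range := lattice_eq_one_of_mem_range
  exists_finite := lattice_exists_finite

/-- The trivial number system on the trivial group. -/
def trivialNumberSystem (Q : Type*) [CommGroup Q] [Subsingleton Q] : NumberSystem Q Bool where
  perm := 1
  st q _ := q
  st_mul _ _ _ := rfl
  base := MonoidHom.id Q
  base_injective := Function.injective_id
  -- Both letters carry the trivial digit: the second one only keeps the alphabet size at two when
  -- the rank is zero.
  digit _ := 1
  zero := false
  digit_zero := rfl
  eq_one_of_digit_mul_base _ _ _ := Subsingleton.elim _ _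
  digit_perm _ _ := Subsingleton.elim _ _
  eq_one_of_mem_range _ _ := Subsingleton.elim _ _
  exists_finite _ _ := ⟨Set.univ, Set.toFinite _, Set.subset_univ _, fun _ _ _ _ => trivial⟩

/-- A number system on `Fin d → ℤ` with two digits. -/
def intNumberSystem : (d : ℕ) → NumberSystem (Multiplicative (Fin d → ℤ)) Bool
  | 0 => trivialNumberSystem _
  | n + 1 => latticeNumberSystem n

end IntegerLattice

/-! ### Finitely generated abelian groups and the main theorem -/

theorem hasFaithfulFiniteStateRecursion_int (l : ℕ) :
    HasFaithfulFiniteStateRecursion (Multiplicative (Fin l → ℤ)) Bool :=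
  ⟨(intNumberSystem l).toWreathRecursion, (intNumberSystem l).isFaithful,
    (intNumberSystem l).isFiniteState⟩

theorem exists_mulEquiv_int_prod_finite (A : Type*) [CommGroup A] [Group.FG A] :
    ∃ (l : ℕ) (B : Type) (_ : CommGroup B) (_ : Finite B),
      Nonempty (A ≃* Multiplicative (Fin l → ℤ) × B) := by
  obtain ⟨ι, j, _, _, p, hp, e, ⟨f⟩⟩ := CommGroup.equiv_free_prod_prod_multiplicative_zmod A
  have (i : ι) : NeZero (p i ^ e i) := ⟨pow_ne_zero _ (hp i).ne_zero⟩
  have (i : ι) : Finite (Multiplicative (ZMod (p i ^ e i))) :=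
    inferInstanceAs (Finite (ZMod (p i ^ e i)))
  let g : (j → Multiplicative ℤ) ≃* Multiplicative (Fin (Fintype.card j) → ℤ) :=
    (MulEquiv.arrowCongr (Fintype.equivFin j) (MulEquiv.refl _)).trans
      (MulEquiv.piMultiplicative _).symm
  exact ⟨Fintype.card j, _, inferInstance, inferInstance, ⟨f.trans (g.prodCongr (.refl _))⟩⟩

theorem card_torsion_of_mulEquiv {A Q B : Type*} [CommGroup A] [CommGroup Q] [IsMulTorsionFree Q]
    [CommGroup B] [Finite B] (e : A ≃* Q × B) : Nat.card (CommGroup.torsion A) = Nat.card B := by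
  symm
  refine Nat.card_congr (Equiv.ofBijective
    (fun b => (⟨e.symm (1, b), ?_⟩ : CommGroup.torsion A)) ⟨fun b c h => ?_, fun a => ?_⟩)
  · obtain ⟨n, hn, h⟩ := isOfFinOrder_iff_pow_eq_one.1 (isOfFinOrder_of_finite b)
    refine isOfFinOrder_iff_pow_eq_one.2 ⟨n, hn, ?_⟩
    rw [← map_pow, Prod.pow_mk, h, one_pow]
    exact map_one _
  · simpa using h
  · obtain ⟨n, hn, h⟩ := isOfFinOrder_iff_pow_eq_one.1 a.2
    have h1 : (e a).1 ^ n = 1 := by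
      rw [← Prod.pow_fst, ← map_pow, h, map_one, Prod.fst_one]
    have h2 : (e a).1 = 1 := (pow_eq_one_iff_left hn.ne').1 h1
    refine ⟨(e a).2, Subtype.ext ?_⟩
    change e.symm (1, (e a).2) = a
    rw [← h2]
    exact e.symm_apply_apply _

theorem theoremC (d : ℕ) :
    (∀ (A : Type*) [CommGroup A] [Group.FG A],
      IsAutomataGroup (2 * Nat.card (CommGroup.torsion A) + 4)
        (RestrictedWreathProduct A (Multiplicative (Fin d → ℤ)))) ∧
    (∀ l : ℕ, IsAutomataGroup 4
      (RestrictedWreathProduct (Multiplicative (Fin l → ℤ)) (Multiplicative (Fin d → ℤ)))) := by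
  refine ⟨fun A _ _ => ?_, fun l => ?_⟩
  · obtain ⟨l, B, _, _, ⟨e⟩⟩ := exists_mulEquiv_int_prod_finite A
    -- Left translation on `B` is already faithful; the factor `Bool` brings the number of letters
    -- to `2 + (2 + 2|B|)`, the degree claimed.
    let ρ : B →* Equiv.Perm (Bool × B) :=
      { toFun := fun b => Equiv.prodCongr (Equiv.refl Bool) (Equiv.mulLeft b)
        map_one' := Equiv.ext fun x => by simp
        map_mul' := fun b c => Equiv.ext fun x => Prod.ext rfl (mul_assoc b c x.2) }
    have hρ : Function.Injective ρ := fun b c h => by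
      simpa [ρ] using Equiv.congr_fun h (true, 1)
    have h := ((hasFaithfulFiniteStateRecursion_int l).prod_finite ρ hρ).transport e
    refine (RestrictedWreathProduct.hasFaithfulFiniteStateRecursion
      (intNumberSystem d) h).isAutomataGroup ?_
    rw [card_torsion_of_mulEquiv e]
    simp only [Nat.card_sum, Nat.card_prod, Nat.card_eq_fintype_card, Fintype.card_bool]
    omega
  · exact (RestrictedWreathProduct.hasFaithfulFiniteStateRecursion
      (intNumberSystem d) (hasFaithfulFiniteStateRecursion_int l)).isAutomataGroup (by simp)
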